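/- Let $k,m,n$ be non-negative integers, let $A\in\mathbb R^{m\times m}$ and $B\in\mathbb R^{m\times k}$ satisfy the rank condition $\operatorname{rank}[B,AB,\dots,A^{m-1}B]=m$, and let $g:\mathbb R^k\times\mathbb R^m\times\mathbb R^n\to\mathbb R^n$ be bounded and Lipschitz continuous in $(y,z)$ uniformly with respect to $u\in\mathbb R^k$. Let $y_0\in\mathbb R^m$, $z_0\in\mathbb R^n$, $T>0$, and let $G:\mathbb R^n\to\mathbb R$ be continuous. Solutions of differential equations are absolutely continuous on $[0,T]$ and satisfy the equation almost everywhere on $[0,T]$. For $\varepsilon>0$ let $$G^*_\varepsilon=\inf G(z(T)),$$ where the infimum is over all (Lebesgue) measurable controls $u:[0,T]\to\mathbb R^k$ and all corresponding solutions $(y,z)$ on $[0,T]$ of $$\varepsilon\,y'(t)=Ay(t)+Bu(t),\quad y(0)=y_0,\qquad z'(t)=g(u(t),y(t),z(t)),\quad z(0)=z_0 .$$ Let $$G^*=\inf G(z(T)),$$ where the infimum is over all measurable functions $u:[0,T]\to\mathbb R^k$ and $y:[0,T]\to\mathbb R^m$ (both acting as controls) and all corresponding solutions $z$ on $[0,T]$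 of $$z'(t)=g(u(t),y(t),z(t)),\quad z(0)=z_0 .$$ Then $G^*_\varepsilon=G^*$ for every $\varepsilon>0$. -/

import Mathlib

open MeasureTheory Set Matrix

noncomputable section

namespace TwoScale

/-- The controllability matrix `[B, AB, ..., A^(m-1) B]`; its columns are indexed by the pairs
(number of the block, column in the block). -/
def controllabilityMatrix {m k : ℕ} (A : Matrix (Fin m) (Fin m) ℝ) (B : Matrix (Fin m) (Fin k) ℝ) :
    Matrix (Fin m) (Fin m × Fin k) ℝ :=
  Matrix.of fun i p => (A ^ (p.1 : ℕ) * B) i p.2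

/-- Lebesgue measurability on `[0, T]` of a function with values in `ℝ^d`. -/
def IsControl {d : ℕ} (T : ℝ) (u : ℝ → (Fin d → ℝ)) : Prop :=
  AEMeasurable u (volume.restrict (Icc 0 T))

/-- `x` is a (Caratheodory) solution on `[0, T]` of `c x'(t) = f t (x t)`, `x 0 = x₀`: it is
absolutely continuous on `[0, T]` and satisfies the equation almost everywhere there. -/
structure IsSolution {d : ℕ} (T c : ℝ) (f : ℝ → (Fin d → ℝ) → (Fin d → ℝ)) (x₀ : Fin d → ℝ)
    (x : ℝ → (Fin d → ℝ)) : Prop where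
  absolutelyContinuous : AbsolutelyContinuousOnInterval x 0 T
  initial : x 0 = x₀
  ode : ∀ᵐ t ∂(volume.restrict (Icc 0 T)), DifferentiableAt ℝ x t ∧ c • deriv x t = f t (x t)

/-- The `z`-components of the solutions on `[0, T]` of `ε y' = A y + B u`, `z' = g (u, y, z)`,
`y 0 = y₀`, `z 0 = z₀`, over all measurable controls `u`. -/
def coupledTrajectories {k m n : ℕ} (A : Matrix (Fin m) (Fin m) ℝ) (B : Matrix (Fin m) (Fin k) ℝ)
    (g : (Fin k → ℝ) → (Fin m → ℝ) → (Fin n → ℝ) → (Fin n → ℝ))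
    (y₀ : Fin m → ℝ) (z₀ : Fin n → ℝ) (T ε : ℝ) : Set (ℝ → (Fin n → ℝ)) :=
  {z | ∃ (u : ℝ → (Fin k → ℝ)) (y : ℝ → (Fin m → ℝ)), IsControl T u ∧
    IsSolution T ε (fun t η => A *ᵥ η + B *ᵥ u t) y₀ y ∧
    IsSolution T 1 (fun t ζ => g (u t) (y t) ζ) z₀ z}

/-- The solutions on `[0, T]` of `z' = g (u, y, z)`, `z 0 = z₀`, over all measurable `u` and `y`,
which both act as controls. -/
def freeTrajectories {k m n : ℕ}
    (g : (Fin k → ℝ) → (Fin m → ℝ) → (Fin n → ℝ) → (Fin n → ℝ))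
    (z₀ : Fin n → ℝ) (T : ℝ) : Set (ℝ → (Fin n → ℝ)) :=
  {z | ∃ (u : ℝ → (Fin k → ℝ)) (y : ℝ → (Fin m → ℝ)), IsControl T u ∧ IsControl T y ∧
    IsSolution T 1 (fun t ζ => g (u t) (y t) ζ) z₀ z}

/-- The infimum of the terminal cost `G (z T)` over a set of trajectories, taken in the extended
reals, so that no convention about unbounded or empty sets of reals intervenes. -/
def optimalValue {n : ℕ} (G : (Fin n → ℝ) → ℝ) (T : ℝ) (Z : Set (ℝ → (Fin n → ℝ))) : EReal :=
  ⨅ z ∈ Z, (G (z T) : EReal)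

end TwoScale

end

/-!
Write `w = z'` for the velocity of a free trajectory. Coupled trajectories are free trajectories, so
it has to be shown that the terminal value `z T` of a free trajectory is a limit of terminal values
of coupled ones; continuity of `G` does the rest.

The control of the fast variable is not penalized, so by the rank condition a pulse of arbitrarily
short duration steers `y` to any prescribed point (`exists_steering`), and since `g` is bounded a
short pulse hardly influences `z`. Between two pulses `u` is held at a constant value `v`, and `y`
stays near its target `q` if the next pulse comes soon. Hence a constant pair `(v, q)` can be
imitated on any interval, up to an `L¹` error in the velocity that is as small as desired (`follows_const`).

Since `g` need not be measurable in `u`, the given measurable controls cannot be approximated by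
approximating their values. They are sampled instead: `w` and `z` are close in `L¹` to continuous
functions, so on a short interval there is a time `s` at which `(w s, z s)` is close to these, and
the Lipschitz condition makes the constant pair `(u s, y s)` generate nearly the velocity `w` on
that interval (`follows_of_approx`). The controls built in this way are simple functions, which can be
substituted into `g` measurably, so the slow equation has a solution for them (`exists_isArc`), and
Grönwall's inequality bounds its distance from `z` (`exists_coupledTrajectory_near`).

Reachability by simple controls is proved by duality: the reachable states form a subspace, and a
functional that vanishes on the responses to constant controls vanishes, by repeated
differentiation, on the columns of all `A ^ i * B`.
-/

open scoped NNReal ENNReal Topology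

namespace TwoScale

/-! ### Arcs of Carathéodory equations -/

/-- `x` is an *arc* of `x' = f t x` on `[a, b]`: it is Lipschitz on `[a, b]` and satisfies the
equation almost everywhere in `(a, b)`. The derivative is only asked for in the open interval, so
that the values of `x` outside `[a, b]` are irrelevant. -/
structure IsArc {E : Type*} [NormedAddCommGroup E] [NormedSpace ℝ E] (a b : ℝ) (f : ℝ → E → E)
    (x : ℝ → E) : Prop where
  lipschitz : ∃ K : ℝ≥0, LipschitzOnWith K x (Icc a b)
  ode : ∀ᵐ t, t ∈ Ioo a b → HasDerivAt x (f t (x t)) t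

/-- A property of intervals that passes from two adjacent intervals to their union, and that holds
for all short intervals, holds for all intervals. -/
lemma of_short_intervals {Φ : ℝ → ℝ → Prop}
    (hglue : ∀ a c b, a < c → c < b → Φ a c → Φ c b → Φ a b) {h : ℝ} (hh : 0 < h)
    (hshort : ∀ a b, a < b → b - a ≤ h → Φ a b) {a b : ℝ} (hab : a < b) : Φ a b := by
  have key : ∀ (n : ℕ) (a b : ℝ), a < b → b - a ≤ 2 ^ n * h → Φ a b := by
    intro n
    induction n with
    | zero => intro a b hab hn; exact hshort a b hab (by simpa using hn)
    | succ n ih =>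
      intro a b hab hn
      rw [pow_succ] at hn
      exact hglue a ((a + b) / 2) b (by linarith) (by linarith)
        (ih _ _ (by linarith) (by linarith)) (ih _ _ (by linarith) (by linarith))
  obtain ⟨n, hn⟩ := pow_unbounded_of_one_lt ((b - a) / h) (one_lt_two)
  exact key n a b hab ((div_lt_iff₀ hh).1 hn).le

lemma locallyIntegrable_of_bounded {E : Type*} [NormedAddCommGroup E] {F : ℝ → E}
    {C : ℝ} (hF : AEStronglyMeasurable F volume)
    (hC : ∀ t, ‖F t‖ ≤ C) : LocallyIntegrable F volume :=
  (locallyIntegrable_const C).mono hF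
    (Filter.Eventually.of_forall fun t => (hC t).trans (le_abs_self C))

lemma intervalIntegrable_of_bounded {E : Type*} [NormedAddCommGroup E] {F : ℝ → E}
    {C : ℝ} (hF : AEStronglyMeasurable F volume)
    (hC : ∀ t, ‖F t‖ ≤ C) (s t : ℝ) : IntervalIntegrable F volume s t :=
  intervalIntegrable_iff.mpr <| ((locallyIntegrable_of_bounded hF hC).integrableOn_isCompact
    isCompact_uIcc).mono_set uIoc_subset_uIcc

section Arcs

variable {E : Type*} [NormedAddCommGroup E] [NormedSpace ℝ E]

lemma IsArc.continuousOn {a b : ℝ} {f : ℝ → E → E} {x : ℝ → E} (h : IsArc a b f x) :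
    ContinuousOn x (Icc a b) :=
  h.lipschitz.choose_spec.continuousOn

lemma IsArc.congr {a b : ℝ} {f f' : ℝ → E → E} {x x' : ℝ → E} (h : IsArc a b f x)
    (hx : ∀ t ∈ Icc a b, x' t = x t) (hf : ∀ t ∈ Ioo a b, f' t (x t) = f t (x t)) :
    IsArc a b f' x' := by
  obtain ⟨⟨K, hK⟩, hd⟩ := h
  refine ⟨⟨K, fun s hs t ht => by rw [hx s hs, hx t ht]; exact hK hs ht⟩, ?_⟩
  filter_upwards [hd] with t ht hI
  rw [hx t (Ioo_subset_Icc_self hI), hf t hI]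
  refine (ht hI).congr_of_eventuallyEq ?_
  filter_upwards [Icc_mem_nhds hI.1 hI.2] with s hs using hx s hs

lemma IsArc.glue {a c b : ℝ} {f : ℝ → E → E} {x : ℝ → E} (hac : a < c) (hcb : c < b)
    (h₁ : IsArc a c f x) (h₂ : IsArc c b f x) : IsArc a b f x := by
  obtain ⟨⟨K₁, hK₁⟩, hd₁⟩ := h₁
  obtain ⟨⟨K₂, hK₂⟩, hd₂⟩ := h₂
  refine ⟨⟨max K₁ K₂, ?_⟩, ?_⟩
  · refine LipschitzOnWith.of_dist_le_mul fun s hs t ht => ?_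
    have h₁ : ∀ s ∈ Icc a c, ∀ t ∈ Icc a c,
        dist (x s) (x t) ≤ (max K₁ K₂ : ℝ≥0) * dist s t := fun s hs t ht =>
      (hK₁.dist_le_mul s hs t ht).trans
        (mul_le_mul_of_nonneg_right (by exact_mod_cast le_max_left _ _) dist_nonneg)
    have h₂ : ∀ s ∈ Icc c b, ∀ t ∈ Icc c b,
        dist (x s) (x t) ≤ (max K₁ K₂ : ℝ≥0) * dist s t := fun s hs t ht =>
      (hK₂.dist_le_mul s hs t ht).trans
        (mul_le_mul_of_nonneg_right (by exact_mod_cast le_max_right _ _) dist_nonneg)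
    have h₃ : ∀ s ∈ Icc a c, ∀ t ∈ Icc c b,
        dist (x s) (x t) ≤ (max K₁ K₂ : ℝ≥0) * dist s t := by
      intro s hs t ht
      have e : dist s t = dist s c + dist c t := by
        simp only [Real.dist_eq]
        rw [abs_of_nonpos (by linarith [hs.2, ht.1]), abs_of_nonpos (by linarith [hs.2]),
          abs_of_nonpos (by linarith [ht.1])]
        ring
      rw [e, mul_add]
      exact (dist_triangle _ (x c) _).trans (add_le_add (h₁ s hs c ⟨hac.le, le_rfl⟩)
        (h₂ c ⟨le_rfl, hcb.le⟩ t ht))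
    rcases le_total s c with hsc | hsc <;> rcases le_total t c with htc | htc
    · exact h₁ s ⟨hs.1, hsc⟩ t ⟨ht.1, htc⟩
    · exact h₃ s ⟨hs.1, hsc⟩ t ⟨htc, ht.2⟩
    · rw [dist_comm, dist_comm s]; exact h₃ t ⟨ht.1, htc⟩ s ⟨hsc, hs.2⟩
    · exact h₂ s ⟨hsc, hs.2⟩ t ⟨htc, ht.2⟩
  · have hc : ∀ᵐ t : ℝ, t ≠ c := by simp [ae_iff, measure_singleton]
    filter_upwards [hd₁, hd₂, hc] with t h1 h2 h3 hI
    rcases lt_or_gt_of_ne h3 with h | h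
    · exact h1 ⟨hI.1, h⟩
    · exact h2 ⟨h, hI.2⟩

/-- Concatenation of an arc of `f₁` on `[a, c]` with an arc of `f₂` on `[c, b]`. -/
lemma IsArc.concat {a c b : ℝ} {f₁ f₂ : ℝ → E → E} {x₁ x₂ : ℝ → E} (hac : a < c) (hcb : c < b)
    (h₁ : IsArc a c f₁ x₁) (h₂ : IsArc c b f₂ x₂) (hx : x₁ c = x₂ c) :
    IsArc a b (fun t => if t ≤ c then f₁ t else f₂ t) (fun t => if t ≤ c then x₁ t else x₂ t) := by
  refine IsArc.glue hac hcb (h₁.congr ?_ ?_) (h₂.congr ?_ ?_)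
  · intro t ht; simp [ht.2]
  · intro t ht; simp [ht.2.le]
  · intro t ht
    rcases ht.1.eq_or_lt with rfl | h
    · simp [hx]
    · simp [not_le.2 h]
  · intro t ht; simp [not_le.2 ht.1]

lemma IsArc.shift {a b : ℝ} {f : ℝ → E → E} {x : ℝ → E} (h : IsArc a b f x) (c : ℝ) :
    IsArc (a + c) (b + c) (fun t => f (t - c)) (fun t => x (t - c)) := by
  obtain ⟨⟨K, hK⟩, hd⟩ := h
  refine ⟨⟨K, LipschitzOnWith.of_dist_le_mul fun s hs t ht => ?_⟩, ?_⟩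
  · have := hK.dist_le_mul (s - c) ⟨by linarith [hs.1], by linarith [hs.2]⟩ (t - c)
      ⟨by linarith [ht.1], by linarith [ht.2]⟩
    simpa using this
  · have := (measurePreserving_sub_right (volume : Measure ℝ) c).quasiMeasurePreserving.ae hd
    filter_upwards [this] with t ht hI
    exact (ht ⟨by linarith [hI.1], by linarith [hI.2]⟩).comp_sub_const t c

lemma IsArc.mono {a b a' b' : ℝ} {f : ℝ → E → E} {x : ℝ → E} (h : IsArc a b f x)
    (ha : a ≤ a') (hb : b' ≤ b) : IsArc a' b' f x := by
  obtain ⟨⟨K, hK⟩, hd⟩ := h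
  refine ⟨⟨K, hK.mono (Icc_subset_Icc ha hb)⟩, ?_⟩
  filter_upwards [hd] with t ht hI using ht ⟨ha.trans_lt hI.1, hI.2.trans_le hb⟩

variable [CompleteSpace E]

lemma isArc_of_integral {a b C : ℝ} {F : ℝ → E} (hF : AEStronglyMeasurable F volume)
    (hC : ∀ t, ‖F t‖ ≤ C) {f : ℝ → E → E} {x : ℝ → E} {x₀ : E}
    (hx : ∀ t, x t = x₀ + ∫ s in a..t, F s) (hf : ∀ t ∈ Ioo a b, F t = f t (x t)) :
    IsArc a b f x := by
  have hint := intervalIntegrable_of_bounded hF hC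
  refine ⟨⟨C.toNNReal, LipschitzOnWith.of_dist_le_mul fun s _ t _ => ?_⟩, ?_⟩
  · have hC0 : 0 ≤ C := (norm_nonneg _).trans (hC 0)
    rw [dist_eq_norm, hx, hx, add_sub_add_left_eq_sub,
      intervalIntegral.integral_interval_sub_left (hint _ _) (hint _ _), Real.coe_toNNReal _ hC0,
      Real.dist_eq]
    exact intervalIntegral.norm_integral_le_of_norm_le_const fun t _ => hC t
  · filter_upwards 
      [LocallyIntegrable.ae_hasDerivAt_integral (locallyIntegrable_of_bounded hF hC)] with t ht hI
    rw [← hf t hI, funext hx]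
    exact (ht a).const_add x₀

/-- Existence of arcs for right-hand sides that are uniformly Lipschitz in `x`, and merely
measurable in `t` along continuous functions: on short intervals the integral operator is a
contraction, and long intervals are bisected. -/
theorem exists_isArc {f : ℝ → E → E} {K : ℝ≥0} {C : ℝ} (hf : ∀ t, LipschitzWith K (f t))
    (hC : ∀ t, ‖f t 0‖ ≤ C)
    (hm : ∀ x : ℝ → E, Continuous x → AEStronglyMeasurable (fun t => f t (x t)) volume)
    {a b : ℝ} (hab : a < b) (x₀ : E) : ∃ x, IsArc a b f x ∧ x a = x₀ := by
  revert x₀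
  -- on intervals of length at most `1 / (2 (K + 1))` the contraction factor is `1 / 2`
  have hh : 0 < 1 / (2 * ((K : ℝ) + 1)) := by positivity
  refine of_short_intervals (Φ := fun a b => ∀ x₀, ∃ x, IsArc a b f x ∧ x a = x₀) ?_ hh ?_ hab
  · intro a c b hac hcb h₁ h₂ x₀
    obtain ⟨x, hx, hxa⟩ := h₁ x₀
    obtain ⟨y, hy, hyc⟩ := h₂ (x c)
    refine ⟨_, (hx.concat hac hcb hy hyc.symm).congr (fun _ _ => rfl) ?_, ?_⟩
    · intro t _; split_ifs <;> rfl
    · simp [hac.le, hxa]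
  · intro a b hab hshort x₀
    let ext : C(Icc a b, E) → ℝ → E := fun x => IccExtend hab.le x
    have hext : ∀ x, Continuous (ext x) := fun x => x.continuous.Icc_extend'
    have hbd : ∀ x : C(Icc a b, E), ∀ t, ‖f t (ext x t)‖ ≤ C + K * ‖x‖ := by
      intro x t
      have h1 : ‖f t (ext x t) - f t 0‖ ≤ K * ‖ext x t - 0‖ := (hf t).norm_sub_le _ _
      have h2 : ‖ext x t‖ ≤ ‖x‖ := x.norm_coe_le_norm _
      have h3 := norm_sub_norm_le (f t (ext x t)) (f t 0)
      rw [sub_zero] at h1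
      have := mul_le_mul_of_nonneg_left h2 K.2
      linarith [hC t, show ((K : ℝ)) * ‖ext x t‖ ≤ K * ‖x‖ from this]
    have hint : ∀ x : C(Icc a b, E), ∀ s t,
        IntervalIntegrable (fun r => f r (ext x r)) volume s t :=
      fun x => intervalIntegrable_of_bounded (hm _ (hext x)) (hbd x)
    let Ψ : C(Icc a b, E) → C(Icc a b, E) := fun x =>
      ⟨fun t => x₀ + ∫ s in a..(t : ℝ), f s (ext x s), by
        have := intervalIntegral.continuous_primitive (μ := volume) (hint x) a
        fun_prop⟩
    have hΨ : ContractingWith (1 / 2) Ψ := by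
      refine ⟨by norm_num [← NNReal.coe_lt_coe], LipschitzWith.of_dist_le_mul fun x y => ?_⟩
      refine (ContinuousMap.dist_le (by positivity)).2 fun t => ?_
      have e : dist (Ψ x t) (Ψ y t) =
          ‖∫ s in a..(t : ℝ), (f s (ext x s) - f s (ext y s))‖ := by
        rw [intervalIntegral.integral_sub (hint x _ _) (hint y _ _), dist_eq_norm]
        simp [Ψ]
      rw [e]
      have h1 : ‖∫ s in a..(t : ℝ), (f s (ext x s) - f s (ext y s))‖ ≤
          (K * dist x y) * |(t : ℝ) - a| := by
        refine intervalIntegral.norm_integral_le_of_norm_le_const fun s _ => ?_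
        rw [← dist_eq_norm]
        refine ((hf s).dist_le_mul _ _).trans (mul_le_mul_of_nonneg_left ?_ K.2)
        exact ContinuousMap.dist_apply_le_dist _
      refine h1.trans ?_
      have h2 : |(t : ℝ) - a| ≤ 1 / (2 * ((K : ℝ) + 1)) := by
        rw [abs_of_nonneg (by linarith [t.2.1])]
        linarith [t.2.2]
      have h3 : (K : ℝ) * |(t : ℝ) - a| ≤ 1 / 2 := by
        refine (mul_le_mul_of_nonneg_left h2 K.2).trans ?_
        have : (0 : ℝ) ≤ K := K.2
        change (K : ℝ) * _ ≤ _
        rw [mul_one_div, div_le_div_iff₀ (by positivity) (by norm_num)]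
        linarith
      have := mul_le_mul_of_nonneg_right h3 (dist_nonneg (x := x) (y := y))
      push_cast
      linarith
    have hfix : Ψ (hΨ.fixedPoint) = hΨ.fixedPoint := hΨ.fixedPoint_isFixedPt
    set y := hΨ.fixedPoint
    refine ⟨fun t => x₀ + ∫ s in a..t, f s (ext y s), ?_, by simp⟩
    refine isArc_of_integral (hm _ (hext y)) (hbd y) (fun _ => rfl) fun t ht => ?_
    have h1 : ext y t = y ⟨t, Ioo_subset_Icc_self ht⟩ := IccExtend_of_mem _ _ _
    have h2 := congrArg (fun z : C(Icc a b, E) => z ⟨t, Ioo_subset_Icc_self ht⟩) hfix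
    rw [h1, ← h2]
    rfl

end Arcs

/-! ### Steering the linear system with finitely-valued controls -/

section Steering

variable {k m : ℕ}

/-- `y` is an arc of `ε y' = A y + B u` on `[a, b]`. Controls are simple functions: as they take
finitely many values, no regularity of a nonlinearity in its control argument is needed to
substitute them into it, and they form a vector space. -/
def IsControlArc (A : Matrix (Fin m) (Fin m) ℝ) (B : Matrix (Fin m) (Fin k) ℝ) (ε a b : ℝ)
    (u : SimpleFunc ℝ (Fin k → ℝ)) (y : ℝ → (Fin m → ℝ)) : Prop :=
  IsArc a b (fun t η => ε⁻¹ • (A *ᵥ η + B *ᵥ u t)) y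

variable {A : Matrix (Fin m) (Fin m) ℝ} {B : Matrix (Fin m) (Fin k) ℝ} {ε : ℝ}

lemma exists_isControlArc (A : Matrix (Fin m) (Fin m) ℝ) (B : Matrix (Fin m) (Fin k) ℝ) (ε : ℝ)
    {a b : ℝ} (hab : a < b) (u : SimpleFunc ℝ (Fin k → ℝ)) (y₀ : Fin m → ℝ) :
    ∃ y, IsControlArc A B ε a b u y ∧ y a = y₀ := by
  let L : (Fin m → ℝ) →L[ℝ] (Fin m → ℝ) := LinearMap.toContinuousLinearMap (ε⁻¹ • A.mulVecLin)
  have hL : ∀ η, L η = ε⁻¹ • (A *ᵥ η) := fun η => by simp [L]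
  obtain ⟨C, hC⟩ := (u.map fun v => ε⁻¹ • (B *ᵥ v)).exists_forall_norm_le
  have hf : ∀ t η, ε⁻¹ • (A *ᵥ η + B *ᵥ u t) = L η + (u.map fun v => ε⁻¹ • (B *ᵥ v)) t := by
    intro t η; rw [hL, smul_add]; rfl
  refine exists_isArc (f := fun t η => ε⁻¹ • (A *ᵥ η + B *ᵥ u t)) (K := ‖L‖₊) (C := C)
    ?_ ?_ ?_ hab y₀
  · intro t
    simp only [hf]
    exact LipschitzWith.of_dist_le_mul fun x y => by
      rw [dist_add_right]; exact L.lipschitz.dist_le_mul x y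
  · intro t
    simpa [hf] using hC t
  · intro x hx
    simp only [hf]
    exact (L.continuous.comp hx).aestronglyMeasurable.add
      (SimpleFunc.measurable _).aestronglyMeasurable

lemma IsControlArc.add {a b : ℝ} {u v : SimpleFunc ℝ (Fin k → ℝ)} {y z : ℝ → (Fin m → ℝ)}
    (hy : IsControlArc A B ε a b u y) (hz : IsControlArc A B ε a b v z) :
    IsControlArc A B ε a b (u + v) (fun t => y t + z t) := by
  obtain ⟨⟨K₁, hK₁⟩, hd₁⟩ := hy
  obtain ⟨⟨K₂, hK₂⟩, hd₂⟩ := hz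
  refine ⟨⟨K₁ + K₂, hK₁.add hK₂⟩, ?_⟩
  filter_upwards [hd₁, hd₂] with t h1 h2 hI
  convert (h1 hI).add (h2 hI) using 1
  · rfl
  · simp only [SimpleFunc.coe_add, Pi.add_apply, mulVec_add, smul_add]
    abel

lemma IsControlArc.smul {a b : ℝ} {u : SimpleFunc ℝ (Fin k → ℝ)} {y : ℝ → (Fin m → ℝ)} (c : ℝ)
    (hy : IsControlArc A B ε a b u y) :
    IsControlArc A B ε a b (c • u) (fun t => c • y t) := by
  obtain ⟨⟨K, hK⟩, hd⟩ := hy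
  refine ⟨⟨‖c‖₊ * K, LipschitzOnWith.of_dist_le_mul fun s hs t ht => ?_⟩, ?_⟩
  · rw [dist_smul₀, NNReal.coe_mul, mul_assoc]
    exact mul_le_mul_of_nonneg_left (hK.dist_le_mul s hs t ht) (norm_nonneg c)
  · filter_upwards [hd] with t h1 hI
    convert (h1 hI).const_smul c using 1
    · rfl
    · simp only [SimpleFunc.coe_smul, Pi.smul_apply, mulVec_smul, ← smul_add]
      rw [smul_comm]

lemma isControlArc_zero (a b : ℝ) :
    IsControlArc A B ε a b 0 (fun _ => 0) := by
  refine ⟨⟨0, (LipschitzWith.const (0 : Fin m → ℝ)).lipschitzOnWith⟩,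
    Filter.Eventually.of_forall fun t _ => ?_⟩
  simpa using hasDerivAt_const t (0 : Fin m → ℝ)

lemma IsControlArc.shift {a b : ℝ} {u : SimpleFunc ℝ (Fin k → ℝ)} {y : ℝ → (Fin m → ℝ)}
    (hy : IsControlArc A B ε a b u y) (c : ℝ) :
    IsControlArc A B ε (a + c) (b + c) (u.comp (fun t => t - c) (measurable_sub_const c))
      (fun t => y (t - c)) :=
  IsArc.shift hy c

lemma IsControlArc.concat {a c b : ℝ} {u v : SimpleFunc ℝ (Fin k → ℝ)} {y z : ℝ → (Fin m → ℝ)}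
    (hac : a < c) (hcb : c < b) (hy : IsControlArc A B ε a c u y)
    (hz : IsControlArc A B ε c b v z) (hyz : y c = z c) :
    IsControlArc A B ε a b (SimpleFunc.piecewise (Iic c) measurableSet_Iic u v)
      (fun t => if t ≤ c then y t else z t) := by
  refine (IsArc.concat hac hcb hy hz hyz).congr (fun _ _ => rfl) fun t _ => ?_
  by_cases h : t ≤ c <;> simp [SimpleFunc.piecewise_apply, h]

/-- The states reachable at time `τ` from the origin. -/
def reachable (A : Matrix (Fin m) (Fin m) ℝ) (B : Matrix (Fin m) (Fin k) ℝ) (ε τ : ℝ) :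
    Submodule ℝ (Fin m → ℝ) where
  carrier := {x | ∃ u y, IsControlArc A B ε 0 τ u y ∧ y 0 = 0 ∧ y τ = x}
  add_mem' := by
    rintro _ _ ⟨u, y, hy, hy0, rfl⟩ ⟨v, z, hz, hz0, rfl⟩
    exact ⟨_, _, hy.add hz, by simp [hy0, hz0], rfl⟩
  zero_mem' := ⟨_, _, isControlArc_zero 0 τ, rfl, rfl⟩
  smul_mem' := by
    rintro c _ ⟨u, y, hy, hy0, rfl⟩
    exact ⟨_, _, hy.smul c, by simp [hy0], rfl⟩

/-- The response from the origin to a constant control is reachable at time `τ` at every time of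
`[0, τ]`: switch the control on late. -/
lemma IsControlArc.mem_reachable {τ σ : ℝ} {v : Fin k → ℝ} {y : ℝ → (Fin m → ℝ)}
    (hy : IsControlArc A B ε 0 τ (SimpleFunc.const ℝ v) y) (hy0 : y 0 = 0)
    (hσ : σ ∈ Icc 0 τ) : y σ ∈ reachable A B ε τ := by
  rcases hσ.1.eq_or_lt with rfl | h0
  · rw [hy0]; exact zero_mem _
  rcases hσ.2.eq_or_lt with rfl | h1
  · exact ⟨_, _, hy, hy0, rfl⟩
  have hs : IsControlArc A B ε 0 σ (SimpleFunc.const ℝ v) y := IsArc.mono hy le_rfl h1.le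
  have hs' := hs.shift (τ - σ)
  rw [zero_add, add_sub_cancel] at hs'
  refine ⟨_, _, (isControlArc_zero 0 (τ - σ)).concat (by linarith) (by linarith) hs' ?_, ?_, ?_⟩
  · simp [hy0]
  · simp [h1.le]
  · simp [not_le.2 (show τ - σ < τ by linarith)]

/-- A functional that vanishes on the reachable states vanishes on all `A ^ i * B`: differentiate
it repeatedly along the response to a constant control. -/
lemma dual_apply_eq_zero_of_reachable_le_ker (hε : ε ≠ 0) {τ : ℝ} (hτ : 0 < τ)
    {φ : Module.Dual ℝ (Fin m → ℝ)} (hφ : reachable A B ε τ ≤ LinearMap.ker φ) (i : ℕ)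
    (v : Fin k → ℝ) : φ ((A ^ i * B) *ᵥ v) = 0 := by
  obtain ⟨y, hy, hy0⟩ := exists_isControlArc A B ε hτ (SimpleFunc.const ℝ v) 0
  have hstep : ∀ i : ℕ, (∀ σ ∈ Icc 0 τ, φ (A ^ i *ᵥ y σ) = 0) →
      ∀ σ ∈ Icc 0 τ, φ (A ^ i *ᵥ (A *ᵥ y σ + B *ᵥ v)) = 0 := by
    intro i hi
    let ψ : (Fin m → ℝ) →L[ℝ] ℝ := LinearMap.toContinuousLinearMap (φ ∘ₗ (A ^ i).mulVecLin)
    have hψ : ∀ x, ψ x = φ (A ^ i *ᵥ x) := fun x => rfl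
    let Aₗ : (Fin m → ℝ) →L[ℝ] (Fin m → ℝ) := LinearMap.toContinuousLinearMap A.mulVecLin
    have hA : ∀ x, Aₗ x = A *ᵥ x := fun x => rfl
    have hcont : ContinuousOn (fun σ => ψ (Aₗ (y σ) + B *ᵥ v)) (Icc 0 τ) :=
      ψ.continuous.comp_continuousOn ((Aₗ.continuous.comp_continuousOn hy.continuousOn).add
        continuousOn_const)
    have hae : (fun σ => ψ (Aₗ (y σ) + B *ᵥ v)) =ᵐ[volume.restrict (Icc 0 τ)] fun _ => 0 := by
      rw [Filter.EventuallyEq, restrict_Ioo_eq_restrict_Icc.symm,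
        ae_restrict_iff' measurableSet_Ioo]
      filter_upwards [hy.ode] with t ht hI
      have h1 := ψ.hasFDerivAt.comp_hasDerivAt t (ht hI)
      -- `ψ ∘ y` vanishes near `t`
      have h2 : HasDerivAt (ψ ∘ y) 0 t := by
        refine (hasDerivAt_const t (0 : ℝ)).congr_of_eventuallyEq ?_
        filter_upwards [Icc_mem_nhds hI.1 hI.2] with s hs using hi s hs
      have h3 := h1.unique h2
      rw [map_smul, smul_eq_mul] at h3
      exact (mul_eq_zero.1 h3).resolve_left (inv_ne_zero hε)
    intro σ hσ
    exact Measure.eqOn_Icc_of_ae_eq volume hτ.ne hae hcont continuousOn_const hσ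
  have hzero : (∀ σ ∈ Icc 0 τ, φ (A ^ i *ᵥ y σ) = 0) → φ ((A ^ i * B) *ᵥ v) = 0 := by
    intro h
    have := hstep i h 0 ⟨le_rfl, hτ.le⟩
    simpa [hy0, mulVec_mulVec] using this
  refine hzero ?_
  clear hzero
  induction i with
  | zero => intro σ hσ; simpa using hφ (hy.mem_reachable hy0 hσ)
  | succ i ih =>
    intro σ hσ
    have h1 := hstep i ih σ hσ
    have h2 := hstep i ih 0 ⟨le_rfl, hτ.le⟩
    rw [hy0, mulVec_zero, zero_add] at h2
    rw [mulVec_add, map_add, h2, add_zero, mulVec_mulVec, ← pow_succ] at h1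
    exact h1

/-- The rank condition makes every state reachable in an arbitrarily short time. -/
lemma reachable_eq_top (hrank : (controllabilityMatrix A B).rank = m) (hε : ε ≠ 0) {τ : ℝ}
    (hτ : 0 < τ) : reachable A B ε τ = ⊤ := by
  by_contra hne
  obtain ⟨φ, hφ0, hφ⟩ := Submodule.exists_le_ker_of_lt_top _ (lt_top_iff_ne_top.2 hne)
  have hspan : LinearMap.range (controllabilityMatrix A B).mulVecLin = ⊤ := by
    apply Submodule.eq_top_of_finrank_eq
    rw [Module.finrank_fin_fun]
    exact hrank
  have hker : LinearMap.range (controllabilityMatrix A B).mulVecLin ≤ LinearMap.ker φ := by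
    rw [range_mulVecLin, Submodule.span_le]
    rintro _ ⟨p, rfl⟩
    have := dual_apply_eq_zero_of_reachable_le_ker hε hτ hφ (p.1 : ℕ) (Pi.single p.2 1)
    rw [mulVec_single_one] at this
    exact this
  rw [hspan, top_le_iff, LinearMap.ker_eq_top] at hker
  exact hφ0 hker

/-- Any state can be steered to any other over any time interval: correct the uncontrolled motion by
a response from the origin. -/
lemma exists_steering (hrank : (controllabilityMatrix A B).rank = m) (hε : ε ≠ 0) {a b : ℝ}
    (hab : a < b) (p q : Fin m → ℝ) :
    ∃ u y, IsControlArc A B ε a b u y ∧ y a = p ∧ y b = q := by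
  obtain ⟨y, hy, hya⟩ := exists_isControlArc A B ε hab 0 p
  have hmem : q - y b ∈ reachable A B ε (b - a) := by
    rw [reachable_eq_top hrank hε (sub_pos.2 hab)]; trivial
  obtain ⟨v, z, hz, hz0, hzb⟩ := hmem
  have hz' := hz.shift a
  rw [zero_add, sub_add_cancel] at hz'
  exact ⟨_, _, hy.add hz', by simp [hya, hz0], by simp [hzb]⟩

end Steering

/-! ### Following a free trajectory -/

section Following

variable {k m n : ℕ}

/-- From every initial state at time `a`, some simple control makes the velocities `g (u, y, z)`
along the given curve `z` differ from `w` by at most `κ` in `L¹([a, b])`. The Lebesgue integral of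
the possibly nonmeasurable integrand is an upper integral, which is all that is needed. -/
def Follows (A : Matrix (Fin m) (Fin m) ℝ) (B : Matrix (Fin m) (Fin k) ℝ) (ε : ℝ)
    (g : (Fin k → ℝ) → (Fin m → ℝ) → (Fin n → ℝ) → (Fin n → ℝ)) (z w : ℝ → (Fin n → ℝ))
    (a b : ℝ) (κ : ℝ≥0∞) : Prop :=
  ∀ p : Fin m → ℝ, ∃ u y, IsControlArc A B ε a b u y ∧ y a = p ∧
    ∫⁻ t in Ioc a b, ‖g (u t) (y t) (z t) - w t‖ₑ ≤ κ

variable {A : Matrix (Fin m) (Fin m) ℝ} {B : Matrix (Fin m) (Fin k) ℝ} {ε : ℝ}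
  {g : (Fin k → ℝ) → (Fin m → ℝ) → (Fin n → ℝ) → (Fin n → ℝ)} {z w : ℝ → (Fin n → ℝ)}

lemma lintegral_Ioc_add_adjacent (F : ℝ → ℝ≥0∞) {a c b : ℝ} (hac : a ≤ c) (hcb : c ≤ b) :
    ∫⁻ t in Ioc a b, F t = (∫⁻ t in Ioc a c, F t) + ∫⁻ t in Ioc c b, F t := by
  rw [← Ioc_union_Ioc_eq_Ioc hac hcb, lintegral_union measurableSet_Ioc
    (Ioc_disjoint_Ioc_of_le le_rfl)]

lemma exists_concat_lintegral_le {a c b : ℝ} (hac : a < c) (hcb : c < b)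
    {u₁ u₂ : SimpleFunc ℝ (Fin k → ℝ)} {y₁ y₂ : ℝ → (Fin m → ℝ)}
    (h₁ : IsControlArc A B ε a c u₁ y₁) (h₂ : IsControlArc A B ε c b u₂ y₂) (hy : y₁ c = y₂ c) :
    ∃ u y, IsControlArc A B ε a b u y ∧ y a = y₁ a ∧
      ∫⁻ t in Ioc a b, ‖g (u t) (y t) (z t) - w t‖ₑ =
        (∫⁻ t in Ioc a c, ‖g (u₁ t) (y₁ t) (z t) - w t‖ₑ) +
          ∫⁻ t in Ioc c b, ‖g (u₂ t) (y₂ t) (z t) - w t‖ₑ := by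
  refine ⟨_, _, h₁.concat hac hcb h₂ hy, by simp [hac.le], ?_⟩
  rw [lintegral_Ioc_add_adjacent _ hac.le hcb.le]
  congr 1
  · refine setLIntegral_congr_fun measurableSet_Ioc fun t ht => ?_
    simp [SimpleFunc.piecewise_apply, ht.2]
  · refine setLIntegral_congr_fun measurableSet_Ioc fun t ht => ?_
    simp [SimpleFunc.piecewise_apply, not_le.2 ht.1]

lemma Follows.mono {a b : ℝ} {κ κ' : ℝ≥0∞} (h : Follows A B ε g z w a b κ) (hκ : κ ≤ κ') :
    Follows A B ε g z w a b κ' := by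
  intro p
  obtain ⟨u, y, h1, h2, h3⟩ := h p
  exact ⟨u, y, h1, h2, h3.trans hκ⟩

lemma Follows.glue {a c b : ℝ} {F : ℝ → ℝ≥0∞} (hac : a < c) (hcb : c < b)
    (h₁ : Follows A B ε g z w a c (∫⁻ t in Ioc a c, F t))
    (h₂ : Follows A B ε g z w c b (∫⁻ t in Ioc c b, F t)) :
    Follows A B ε g z w a b (∫⁻ t in Ioc a b, F t) := by
  intro p
  obtain ⟨u₁, y₁, hy₁, hp, hκ₁⟩ := h₁ p
  obtain ⟨u₂, y₂, hy₂, hc, hκ₂⟩ := h₂ (y₁ c)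
  obtain ⟨u, y, hy, hya, hκ⟩ := exists_concat_lintegral_le (g := g) (z := z) (w := w) hac hcb
    hy₁ hy₂ hc.symm
  refine ⟨u, y, hy, hya.trans hp, hκ.trans_le ?_⟩
  rw [lintegral_Ioc_add_adjacent _ hac.le hcb.le]
  exact add_le_add hκ₁ hκ₂

/-- The constant pair `(v, q)` can be followed at an arbitrarily small extra cost: on a short
interval, a brief pulse steers `y` to `q`, after which the control `v` keeps `y` near `q`. -/
lemma follows_const (hrank : (controllabilityMatrix A B).rank = m) (hε : ε ≠ 0) {M L : ℝ}
    (hM : ∀ u y z, ‖g u y z‖ ≤ M) (hL₀ : 0 ≤ L)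
    (hL : ∀ u y y' z z', ‖g u y z - g u y' z'‖ ≤ L * (‖y - y'‖ + ‖z - z'‖))
    (hw : ∀ t, ‖w t‖ ≤ M) (v : Fin k → ℝ) (q : Fin m → ℝ) {η : ℝ} (hη : 0 < η) {a b : ℝ}
    (hab : a < b) :
    Follows A B ε g z w a b (∫⁻ t in Ioc a b, (‖g v q (z t) - w t‖ₑ + ENNReal.ofReal η)) := by
  have hM₀ : 0 ≤ M := (norm_nonneg _).trans (hw 0)
  obtain ⟨y₀, hy₀, hq⟩ := exists_isControlArc A B ε one_pos (SimpleFunc.const ℝ v) q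
  -- a waiting time during which the response to the constant control stays near `q`
  obtain ⟨h, hh, hh1, hclose⟩ : ∃ h : ℝ, 0 < h ∧ h ≤ 1 ∧
      ∀ s ∈ Icc 0 h, L * ‖y₀ s - q‖ ≤ η / 2 := by
    have hc : ContinuousWithinAt y₀ (Icc 0 1) 0 := hy₀.continuousOn 0 ⟨le_rfl, zero_le_one⟩
    obtain ⟨d, hd, hd'⟩ := Metric.continuousWithinAt_iff.1 hc (η / (2 * (L + 1))) (by positivity)
    refine ⟨min (d / 2) 1, by positivity, min_le_right _ _, fun s hs => ?_⟩
    have h1 : s ≤ d / 2 := hs.2.trans (min_le_left _ _)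
    have h2 := hd' (x := s) ⟨hs.1, hs.2.trans (min_le_right _ _)⟩ (by
      rw [Real.dist_eq, sub_zero, abs_of_nonneg hs.1]; linarith)
    rw [dist_eq_norm, hq] at h2
    calc L * ‖y₀ s - q‖ ≤ (L + 1) * (η / (2 * (L + 1))) :=
          mul_le_mul (by linarith) h2.le (norm_nonneg _) (by linarith)
      _ = η / 2 := by field_simp
  refine of_short_intervals (Φ := fun a b => Follows A B ε g z w a b
    (∫⁻ t in Ioc a b, (‖g v q (z t) - w t‖ₑ + ENNReal.ofReal η)))
    (fun a c b hac hcb h₁ h₂ => h₁.glue hac hcb h₂) hh (fun a b hab hshort => ?_) hab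
  intro p
  -- the pulse takes the fraction `θ` of the interval, so that it costs at most `η / 2` per unit time
  let θ : ℝ := min (1 / 2) (η / (2 * (2 * M + 1)))
  have hθ : 0 < θ := by positivity
  have hθ1 : θ ≤ 1 / 2 := min_le_left _ _
  have hθ2 : 2 * M * θ ≤ η / 2 :=
    calc 2 * M * θ ≤ (2 * M + 1) * (η / (2 * (2 * M + 1))) :=
          mul_le_mul (by linarith) (min_le_right _ _) hθ.le (by linarith)
      _ = η / 2 := by field_simp
  have hba : 0 < b - a := sub_pos.2 hab
  let c : ℝ := a + θ * (b - a)
  have hac : a < c := by simp only [c]; nlinarith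
  have hcb : c < b := by simp only [c]; nlinarith
  obtain ⟨u₁, y₁, hy₁, hp, hyc⟩ := exists_steering hrank hε hac p q
  have hy₂ : IsControlArc A B ε c b ((SimpleFunc.const ℝ v).comp _ (measurable_sub_const c))
      (fun t => y₀ (t - c)) := by
    have := (IsArc.mono hy₀ le_rfl (show b - c ≤ 1 by linarith) : IsControlArc A B ε 0 (b - c)
      (SimpleFunc.const ℝ v) y₀).shift c
    rwa [zero_add, sub_add_cancel] at this
  obtain ⟨u, y, hy, hya, hκ⟩ := exists_concat_lintegral_le (g := g) (z := z) (w := w) hac hcb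
    hy₁ hy₂ (by simp [hyc, hq])
  refine ⟨u, y, hy, hya.trans hp, hκ.trans_le ?_⟩
  have hpulse : ∫⁻ t in Ioc a c, ‖g (u₁ t) (y₁ t) (z t) - w t‖ₑ ≤
      ENNReal.ofReal (η / 2) * ENNReal.ofReal (b - a) := by
    calc ∫⁻ t in Ioc a c, ‖g (u₁ t) (y₁ t) (z t) - w t‖ₑ
        ≤ ∫⁻ t in Ioc a c, ENNReal.ofReal (2 * M) := by
          refine lintegral_mono fun t => ?_
          rw [← ofReal_norm]
          refine ENNReal.ofReal_le_ofReal ((norm_sub_le _ _).trans ?_)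
          linarith [hM (u₁ t) (y₁ t) (z t), hw t]
      _ = ENNReal.ofReal (2 * M * (c - a)) := by
          rw [setLIntegral_const, Real.volume_Ioc, ENNReal.ofReal_mul (p := 2 * M) (by positivity)]
      _ ≤ ENNReal.ofReal (η / 2 * (b - a)) := by
          refine ENNReal.ofReal_le_ofReal ?_
          simp only [c]
          nlinarith
      _ = _ := ENNReal.ofReal_mul (by positivity)
  have hwait : ∫⁻ t in Ioc c b, ‖g (((SimpleFunc.const ℝ v).comp _ (measurable_sub_const c)) t)
      (y₀ (t - c)) (z t) - w t‖ₑ ≤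
      ∫⁻ t in Ioc a b, (‖g v q (z t) - w t‖ₑ + ENNReal.ofReal (η / 2)) := by
    refine le_trans (setLIntegral_mono' measurableSet_Ioc fun t ht => ?_)
      (lintegral_mono_set (Ioc_subset_Ioc_left hac.le))
    rw [← ofReal_norm, ← ofReal_norm, ← ENNReal.ofReal_add (norm_nonneg _) (by positivity)]
    refine ENNReal.ofReal_le_ofReal ?_
    have h1 := hL v (y₀ (t - c)) q (z t) (z t)
    rw [sub_self, norm_zero, add_zero] at h1
    have h2 := hclose (t - c) ⟨by linarith [ht.1], by linarith [ht.2]⟩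
    have h3 := norm_sub_le_norm_sub_add_norm_sub (g v (y₀ (t - c)) (z t)) (g v q (z t)) (w t)
    simp only [SimpleFunc.coe_comp, SimpleFunc.coe_const, Function.const_comp, Function.const_apply]
    linarith
  refine (add_le_add hpulse hwait).trans ?_
  have hsplit : ENNReal.ofReal η = ENNReal.ofReal (η / 2) + ENNReal.ofReal (η / 2) := by
    rw [← ENNReal.ofReal_add (by positivity) (by positivity), add_halves]
  rw [lintegral_add_right _ measurable_const, lintegral_add_right _ measurable_const,
    setLIntegral_const, setLIntegral_const, Real.volume_Ioc, hsplit]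
  ring_nf
  exact le_rfl

/-- Sampling: on each short interval the measurable pair `(û, ŷ)` is replaced by its value at one
time `s`, chosen by the first moment method so that the velocity and the position at time `s` are
close to their continuous approximation `f`. -/
lemma follows_of_approx (hrank : (controllabilityMatrix A B).rank = m) (hε : ε ≠ 0) {M L : ℝ}
    (hM : ∀ u y z, ‖g u y z‖ ≤ M) (hL₀ : 0 ≤ L)
    (hL : ∀ u y y' z z', ‖g u y z - g u y' z'‖ ≤ L * (‖y - y'‖ + ‖z - z'‖))
    {û : ℝ → (Fin k → ℝ)} {ŷ : ℝ → (Fin m → ℝ)} (hw : ∀ t, w t = g (û t) (ŷ t) (z t))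
    {f : ℝ → (Fin n → ℝ) × (Fin n → ℝ)} (hf : UniformContinuous f) {T : ℝ} (hT : 0 < T)
    (hm : AEStronglyMeasurable (fun t => (w t, z t)) (volume.restrict (Ioc 0 T))) {η : ℝ}
    (hη : 0 < η) :
    Follows A B ε g z w 0 T (∫⁻ t in Ioc 0 T,
      (ENNReal.ofReal (2 * (L + 1)) * ‖(w t, z t) - f t‖ₑ + ENNReal.ofReal η)) := by
  have hη' : 0 < η / (2 * (L + 1)) := by positivity
  obtain ⟨h, hh, hfh⟩ := Metric.uniformContinuous_iff.1 hf _ hη'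
  refine of_short_intervals (Φ := fun a b => 0 ≤ a → b ≤ T → Follows A B ε g z w a b
    (∫⁻ t in Ioc a b, (ENNReal.ofReal (2 * (L + 1)) * ‖(w t, z t) - f t‖ₑ + ENNReal.ofReal η)))
    (fun a c b hac hcb h₁ h₂ ha hb => (h₁ ha (hcb.le.trans hb)).glue hac hcb
      (h₂ (ha.trans hac.le) hb)) (half_pos hh) (fun a b hab hshort ha hb => ?_) hT le_rfl le_rfl
  have hba : 0 < b - a := sub_pos.2 hab
  have hm' : AEMeasurable (fun t => ‖(w t, z t) - f t‖ₑ) (volume.restrict (Ioc a b)) :=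
    ((hm.mono_measure (Measure.restrict_mono (Ioc_subset_Ioc ha hb) le_rfl)).sub
      hf.continuous.aestronglyMeasurable).enorm
  obtain ⟨s, hs, hmean⟩ : ∃ s ∈ Ioc a b, ‖(w s, z s) - f s‖ₑ * ENNReal.ofReal (b - a) ≤
      ∫⁻ t in Ioc a b, ‖(w t, z t) - f t‖ₑ := by
    have hne : volume.restrict (Ioc a b) ≠ 0 := by
      rw [Ne, Measure.restrict_eq_zero, Real.volume_Ioc]; simpa using hab
    obtain ⟨s, hs, hle⟩ := exists_notMem_null_le_laverage (N := (Ioc a b)ᶜ) hne hm'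
      (by rw [Measure.restrict_apply measurableSet_Ioc.compl]; simp)
    refine ⟨s, not_not.1 hs, ?_⟩
    rw [setLAverage_eq, Real.volume_Ioc] at hle
    exact (ENNReal.le_div_iff_mul_le (Or.inl (by simpa using hab)) (Or.inl (by simp))).1 hle
  refine (follows_const hrank hε hM hL₀ hL (fun t => by rw [hw]; exact hM _ _ _) (û s) (ŷ s)
    (half_pos hη) hab).mono ?_
  have hpt : ∀ t ∈ Ioc a b, ‖g (û s) (ŷ s) (z t) - w t‖ₑ + ENNReal.ofReal (η / 2) ≤
      ENNReal.ofReal (L + 1) * ‖(w t, z t) - f t‖ₑ +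
        (ENNReal.ofReal (L + 1) * ‖(w s, z s) - f s‖ₑ + ENNReal.ofReal η) := by
    intro t ht
    have h0 : dist s t < h := by
      rw [Real.dist_eq, abs_lt]; constructor <;> linarith [ht.1, ht.2, hs.1, hs.2]
    have h1 := hL (û s) (ŷ s) (ŷ s) (z t) (z s)
    rw [← hw s, sub_self, norm_zero, zero_add] at h1
    have h2 := norm_sub_le_norm_sub_add_norm_sub (g (û s) (ŷ s) (z t)) (w s) (w t)
    have h3 : ‖z t - z s‖ ≤ ‖(w t, z t) - (w s, z s)‖ := norm_snd_le ((w t, z t) - (w s, z s))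
    have h4 : ‖w s - w t‖ ≤ ‖(w t, z t) - (w s, z s)‖ := by
      rw [norm_sub_rev]; exact norm_fst_le ((w t, z t) - (w s, z s))
    have h5 : ‖(w t, z t) - (w s, z s)‖ ≤ ‖(w t, z t) - f t‖ + ‖(w s, z s) - f s‖ +
        ‖f s - f t‖ := by
      have e : (w t, z t) - (w s, z s) = ((w t, z t) - f t) - ((w s, z s) - f s) - (f s - f t) := by
        abel
      rw [e]
      exact (norm_sub_le _ _).trans (add_le_add (norm_sub_le _ _) le_rfl)
    have h6 : ‖f s - f t‖ ≤ η / (2 * (L + 1)) := by rw [← dist_eq_norm]; exact (hfh h0).le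
    have h7 : (L + 1) * (η / (2 * (L + 1))) = η / 2 := by field_simp
    have h8 : ‖g (û s) (ŷ s) (z t) - w t‖ + η / 2 ≤ (L + 1) * ‖(w t, z t) - f t‖ +
        ((L + 1) * ‖(w s, z s) - f s‖ + η) := by
      have h9 : ‖g (û s) (ŷ s) (z t) - w t‖ ≤ (L + 1) * ‖(w t, z t) - (w s, z s)‖ := by
        nlinarith [mul_le_mul_of_nonneg_left h3 hL₀]
      have h10 := mul_le_mul_of_nonneg_left (h5.trans (add_le_add le_rfl h6))
        (show 0 ≤ L + 1 by linarith)
      rw [mul_add, mul_add, h7] at h10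
      linarith
    rw [← ofReal_norm, ← ofReal_norm, ← ofReal_norm,
      ← ENNReal.ofReal_mul (by linarith), ← ENNReal.ofReal_mul (by linarith),
      ← ENNReal.ofReal_add (by positivity) (by positivity),
      ← ENNReal.ofReal_add (by positivity) (by positivity),
      ← ENNReal.ofReal_add (by positivity) (by positivity)]
    exact ENNReal.ofReal_le_ofReal h8
  refine (setLIntegral_mono' measurableSet_Ioc hpt).trans ?_
  have h2 : ENNReal.ofReal (2 * (L + 1)) = ENNReal.ofReal (L + 1) + ENNReal.ofReal (L + 1) := by
    rw [← ENNReal.ofReal_add (by positivity) (by positivity), two_mul]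
  simp only [lintegral_add_right _ measurable_const, setLIntegral_const, Real.volume_Ioc,
    lintegral_const_mul' _ _ ENNReal.ofReal_ne_top]
  simp only [h2, add_mul, ← add_assoc]
  gcongr

/-- Every free trajectory can be followed with arbitrarily small error. -/
lemma follows_free (hrank : (controllabilityMatrix A B).rank = m) (hε : ε ≠ 0) {M L : ℝ}
    (hM : ∀ u y z, ‖g u y z‖ ≤ M) (hL₀ : 0 ≤ L)
    (hL : ∀ u y y' z z', ‖g u y z - g u y' z'‖ ≤ L * (‖y - y'‖ + ‖z - z'‖))
    {û : ℝ → (Fin k → ℝ)} {ŷ : ℝ → (Fin m → ℝ)} (hw : ∀ t, w t = g (û t) (ŷ t) (z t))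
    {T : ℝ} (hT : 0 < T) (hwm : AEStronglyMeasurable w (volume.restrict (Ioc 0 T)))
    (hz : ContinuousOn z (Icc 0 T)) {δ : ℝ} (hδ : 0 < δ) :
    Follows A B ε g z w 0 T (ENNReal.ofReal δ) := by
  have hwi : IntegrableOn w (Ioc 0 T) :=
    Integrable.of_bound hwm M
      (Filter.Eventually.of_forall fun t => by rw [hw]; exact hM _ _ _)
  have hzi : IntegrableOn z (Ioc 0 T) :=
    (hz.integrableOn_Icc).mono_set Ioc_subset_Icc_self
  have hi : IntegrableOn (fun t => (w t, z t)) (Ioc 0 T) := hwi.prodMk hzi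
  have hd : 0 < δ / 2 / (2 * (L + 1)) := by positivity
  obtain ⟨f, hfs, hfi, hfc, -⟩ := Integrable.exists_hasCompactSupport_lintegral_sub_le hi
    (ENNReal.ofReal_pos.2 hd).ne'
  refine (follows_of_approx hrank hε hM hL₀ hL hw (hfs.uniformContinuous_of_continuous hfc) hT
    hi.aestronglyMeasurable (η := δ / 2 / T) (by positivity)).mono ?_
  rw [lintegral_add_right _ measurable_const, lintegral_const_mul' _ _ ENNReal.ofReal_ne_top,
    setLIntegral_const, Real.volume_Ioc, sub_zero, ← ENNReal.ofReal_mul (by positivity)]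
  refine (add_le_add (mul_le_mul' le_rfl hfi) le_rfl).trans ?_
  rw [← ENNReal.ofReal_mul (by positivity), ← ENNReal.ofReal_add (by positivity) (by positivity)]
  refine ENNReal.ofReal_le_ofReal (le_of_eq ?_)
  field_simp
  ring

end Following

/-! ### Comparison of trajectories -/

section Comparison

lemma ae_ne_and_ne (a b : ℝ) : ∀ᵐ t : ℝ, t ≠ a ∧ t ≠ b := by
  have h : ∀ c : ℝ, ∀ᵐ t : ℝ, t ≠ c := fun c => by simp [ae_iff, measure_singleton]
  filter_upwards [h a, h b] with t ha hb using ⟨ha, hb⟩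

/-- The fundamental theorem of calculus for an absolutely continuous curve in a Banach space with a
bounded almost everywhere derivative. -/
lemma eq_integral_of_ae_hasDerivAt {E : Type*} [NormedAddCommGroup E] [NormedSpace ℝ E]
    [CompleteSpace E] {d D : ℝ → E} {T C : ℝ} (hT : 0 ≤ T)
    (hd : AbsolutelyContinuousOnInterval d 0 T) (h₀ : d 0 = 0)
    (hD : ∀ᵐ t, t ∈ Ioo 0 T → HasDerivAt d (D t) t)
    (hDm : AEStronglyMeasurable D (volume.restrict (Ioc 0 T))) (hC : ∀ t, ‖D t‖ ≤ C) :
    ∀ t ∈ Icc 0 T, d t = ∫ s in 0..t, D s := by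
  let D' : ℝ → E := (Ioc 0 T).indicator D
  have hD' : ∀ t ∈ Ioc 0 T, D' t = D t := fun t ht => indicator_of_mem ht D
  have harc : IsArc 0 T (fun t _ => D' t) (fun t => 0 + ∫ s in 0..t, D' s) :=
    isArc_of_integral ((aestronglyMeasurable_indicator_iff measurableSet_Ioc).2 hDm)
      (fun t => (norm_indicator_le_norm_self _ _).trans (hC t)) (fun _ => rfl) (fun _ _ => rfl)
  obtain ⟨K, hK⟩ := harc.lipschitz
  rw [← uIcc_of_le hT] at hK
  obtain ⟨c, hc⟩ := (hd.sub hK.absolutelyContinuousOnInterval).const_of_ae_hasDerivAt_zero (by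
    filter_upwards [hD, harc.ode, ae_ne_and_ne 0 T] with t h1 h2 h3 ht
    rw [uIcc_of_le hT] at ht
    have hI : t ∈ Ioo 0 T := ⟨lt_of_le_of_ne ht.1 (Ne.symm h3.1), lt_of_le_of_ne ht.2 h3.2⟩
    have := (h1 hI).sub (h2 hI)
    rwa [hD' t (Ioo_subset_Ioc_self hI), sub_self] at this)
  intro t ht
  have hc0 := hc 0 left_mem_uIcc
  have hct := hc t (by rwa [uIcc_of_le hT])
  simp only [Pi.sub_apply, h₀, intervalIntegral.integral_same, zero_add, sub_zero] at hc0 hct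
  rw [← hc0, sub_eq_zero] at hct
  rw [hct]
  refine intervalIntegral.integral_congr_ae (Filter.Eventually.of_forall fun s hs => ?_)
  rw [uIoc_of_le ht.1] at hs
  exact hD' s ⟨hs.1, hs.2.trans ht.2⟩

/-- Grönwall's inequality in integral form. -/
lemma le_mul_exp_of_le_integral {φ : ℝ → ℝ} {T L δ : ℝ} (hφ : Continuous φ) (hφ₀ : ∀ t, 0 ≤ φ t)
    (hL : 0 ≤ L) (h : ∀ t ∈ Icc 0 T, φ t ≤ δ + L * ∫ s in 0..t, φ s) :
    ∀ t ∈ Icc 0 T, φ t ≤ δ * Real.exp (L * t) := by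
  intro t ht
  have hψ : ∀ s, HasDerivAt (fun t => δ + L * ∫ s in 0..t, φ s) (L * φ s) s := fun s =>
    ((intervalIntegral.integral_hasDerivAt_right (hφ.intervalIntegrable _ _)
      (hφ.stronglyMeasurableAtFilter _ _) hφ.continuousAt).const_mul L).const_add δ
  have hδ : 0 ≤ δ := by
    have := (hφ₀ 0).trans (h 0 ⟨le_rfl, ht.1.trans ht.2⟩)
    simpa using this
  have := norm_le_gronwallBound_of_norm_deriv_right_le (δ := δ) (K := L) (ε := 0) (a := 0) (b := T)
    (f := fun t => δ + L * ∫ s in 0..t, φ s) (f' := fun s => L * φ s)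
    (fun s _ => (hψ s).continuousAt.continuousWithinAt) (fun s _ => (hψ s).hasDerivWithinAt)
    (by simp [abs_of_nonneg hδ]) (fun s hs => by
      rw [add_zero, norm_mul, Real.norm_of_nonneg hL, Real.norm_of_nonneg (hφ₀ s)]
      exact mul_le_mul_of_nonneg_left ((h s ⟨hs.1, hs.2.le⟩).trans (le_abs_self _)) hL) t ht
  rw [gronwallBound_ε0, sub_zero] at this
  exact (h t ht).trans ((le_abs_self _).trans this)

/-- A curve whose velocity is at most `L ‖d t‖ + ‖e t‖`, with `e` small in `L¹`, stays small. -/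
lemma norm_le_of_ae_hasDerivAt {E : Type*} [NormedAddCommGroup E] [NormedSpace ℝ E]
    [CompleteSpace E] {d D e : ℝ → E} {T C L δ : ℝ} (hT : 0 ≤ T)
    (hd : AbsolutelyContinuousOnInterval d 0 T) (h₀ : d 0 = 0)
    (hD : ∀ᵐ t, t ∈ Ioo 0 T → HasDerivAt d (D t) t)
    (hDm : AEStronglyMeasurable D (volume.restrict (Ioc 0 T))) (hC : ∀ t, ‖D t‖ ≤ C)
    (hem : AEStronglyMeasurable e (volume.restrict (Ioc 0 T)))
    (he : ∫⁻ t in Ioc 0 T, ‖e t‖ₑ ≤ ENNReal.ofReal δ) (hδ : 0 ≤ δ) (hL : 0 ≤ L)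
    (hle : ∀ t, ‖D t‖ ≤ L * ‖d t‖ + ‖e t‖) :
    ‖d T‖ ≤ δ * Real.exp (L * T) := by
  have hdc : ContinuousOn d (Icc 0 T) := by simpa [uIcc_of_le hT] using hd.continuousOn
  -- the Grönwall inequality is applied to a continuous extension of `‖d ·‖`
  let φ : ℝ → ℝ := fun t => ‖IccExtend hT ((Icc 0 T).domRestrict d) t‖
  have hφ : Continuous φ := (continuousOn_iff_continuous_domRestrict.1 hdc).Icc_extend'.norm
  have hφd : ∀ t ∈ Icc 0 T, φ t = ‖d t‖ := fun t ht => by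
    simp only [φ]; rw [IccExtend_of_mem _ _ ht]; rfl
  have hei : IntegrableOn e (Ioc 0 T) := ⟨hem, he.trans_lt ENNReal.ofReal_lt_top⟩
  have heI : ∫ t in Ioc 0 T, ‖e t‖ ≤ δ := by
    rw [integral_norm_eq_lintegral_enorm hem]
    exact ENNReal.toReal_le_of_le_ofReal hδ he
  have hDi : IntegrableOn D (Ioc 0 T) :=
    Integrable.of_bound hDm C (Filter.Eventually.of_forall hC)
  rw [← hφd T ⟨hT, le_rfl⟩]
  refine le_mul_exp_of_le_integral hφ (fun t => norm_nonneg _) hL (fun t ht => ?_) T ⟨hT, le_rfl⟩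
  have hsub : Ioc 0 t ⊆ Ioc 0 T := Ioc_subset_Ioc_right ht.2
  rw [hφd t ht, eq_integral_of_ae_hasDerivAt hT hd h₀ hD hDm hC t ht,
    intervalIntegral.integral_of_le ht.1, intervalIntegral.integral_of_le ht.1]
  have hφi : IntegrableOn φ (Ioc 0 t) := hφ.integrableOn_Ioc
  calc ‖∫ s in Ioc 0 t, D s‖ ≤ ∫ s in Ioc 0 t, ‖D s‖ := norm_integral_le_integral_norm _
    _ ≤ ∫ s in Ioc 0 t, (‖e s‖ + L * φ s) := by
        refine setIntegral_mono_on (hDi.mono_set hsub).norm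
          ((hei.mono_set hsub).norm.add (hφi.const_mul L)) measurableSet_Ioc fun s hs => ?_
        rw [hφd s ⟨hs.1.le, hs.2.trans ht.2⟩]
        linarith [hle s]
    _ = (∫ s in Ioc 0 t, ‖e s‖) + L * ∫ s in Ioc 0 t, φ s := by
        rw [integral_add (hei.mono_set hsub).norm (hφi.const_mul L), integral_const_mul]
    _ ≤ δ + L * ∫ s in Ioc 0 t, φ s := by
        refine add_le_add (le_trans ?_ heI) le_rfl
        exact setIntegral_mono_set hei.norm (Filter.Eventually.of_forall fun _ => norm_nonneg _)
          hsub.eventuallyLE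

variable {k m n : ℕ}

lemma isSolution_of_isArc {d : ℕ} {T c : ℝ} (hT : 0 ≤ T) {f f' : ℝ → (Fin d → ℝ) → (Fin d → ℝ)}
    {x : ℝ → (Fin d → ℝ)} (h : IsArc 0 T f x) (hf : ∀ t ∈ Ioo 0 T, c • f t (x t) = f' t (x t)) :
    IsSolution T c f' (x 0) x := by
  obtain ⟨⟨K, hK⟩, hd⟩ := h
  refine ⟨?_, rfl, ?_⟩
  · rw [← uIcc_of_le hT] at hK
    exact hK.absolutelyContinuousOnInterval
  · rw [← restrict_Ioo_eq_restrict_Icc, ae_restrict_iff' measurableSet_Ioo]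
    filter_upwards [hd] with t ht hI
    exact ⟨(ht hI).differentiableAt, by rw [(ht hI).deriv]; exact hf t hI⟩

/-- A simple control can be substituted into `g` measurably, although `g` need not be measurable in
its control argument. -/
lemma measurable_comp_simpleFunc {g : (Fin k → ℝ) → (Fin m → ℝ) → (Fin n → ℝ) → (Fin n → ℝ)}
    {L : ℝ} (hL₀ : 0 ≤ L)
    (hL : ∀ u y y' z z', ‖g u y z - g u y' z'‖ ≤ L * (‖y - y'‖ + ‖z - z'‖))
    (u : SimpleFunc ℝ (Fin k → ℝ)) {y : ℝ → (Fin m → ℝ)} {z : ℝ → (Fin n → ℝ)}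
    (hy : Continuous y) (hz : Continuous z) : Measurable fun t => g (u t) (y t) (z t) := by
  refine u.measurable_bind (fun v t => g v (y t) (z t)) fun v => ?_
  have hg : LipschitzWith (2 * L).toNNReal fun p : (Fin m → ℝ) × (Fin n → ℝ) => g v p.1 p.2 := by
    refine LipschitzWith.of_dist_le_mul fun p p' => ?_
    rw [dist_eq_norm, dist_eq_norm, Real.coe_toNNReal _ (by positivity)]
    refine (hL _ _ _ _ _).trans ?_
    have h1 := mul_le_mul_of_nonneg_left (norm_fst_le (p - p')) hL₀
    have h2 := mul_le_mul_of_nonneg_left (norm_snd_le (p - p')) hL₀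
    rw [Prod.fst_sub] at h1
    rw [Prod.snd_sub] at h2
    linarith
  exact (hg.continuous.comp (hy.prodMk hz)).measurable

/-- The terminal value of a free trajectory is a limit of terminal values of coupled ones. -/
lemma exists_coupledTrajectory_near {A : Matrix (Fin m) (Fin m) ℝ} {B : Matrix (Fin m) (Fin k) ℝ}
    (hrank : (controllabilityMatrix A B).rank = m)
    {g : (Fin k → ℝ) → (Fin m → ℝ) → (Fin n → ℝ) → (Fin n → ℝ)} {M L : ℝ}
    (hM : ∀ u y z, ‖g u y z‖ ≤ M) (hL₀ : 0 ≤ L)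
    (hL : ∀ u y y' z z', ‖g u y z - g u y' z'‖ ≤ L * (‖y - y'‖ + ‖z - z'‖))
    (y₀ : Fin m → ℝ) (z₀ : Fin n → ℝ) {T : ℝ} (hT : 0 < T) {ε : ℝ} (hε : ε ≠ 0)
    {z : ℝ → (Fin n → ℝ)} (hz : z ∈ freeTrajectories g z₀ T) {δ : ℝ} (hδ : 0 < δ) :
    ∃ x ∈ coupledTrajectories A B g y₀ z₀ T ε, ‖x T - z T‖ ≤ δ := by
  obtain ⟨û, ŷ, -, -, hac, hz0, hode⟩ := hz
  rw [← restrict_Ioo_eq_restrict_Icc, ae_restrict_iff' measurableSet_Ioo] at hode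
  have hzc : ContinuousOn z (Icc 0 T) := by simpa [uIcc_of_le hT.le] using hac.continuousOn
  let w : ℝ → (Fin n → ℝ) := fun t => g (û t) (ŷ t) (z t)
  have hzw : ∀ᵐ t, t ∈ Ioo 0 T → HasDerivAt z (w t) t := by
    filter_upwards [hode] with t ht hI
    have h1 := (ht hI).1.hasDerivAt
    have h2 := (ht hI).2
    rw [one_smul] at h2
    rwa [h2] at h1
  -- the velocity is measurable because it is almost everywhere a derivative
  have hwm : AEStronglyMeasurable w (volume.restrict (Ioc 0 T)) := by
    refine (aestronglyMeasurable_deriv z _).congr ?_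
    rw [Filter.EventuallyEq, ← restrict_Ioo_eq_restrict_Ioc, ae_restrict_iff' measurableSet_Ioo]
    filter_upwards [hzw] with t ht hI using (ht hI).deriv
  let δ' := δ / Real.exp (L * T)
  have hδ' : 0 < δ' := by positivity
  obtain ⟨u, y, hy, hy0, hκ⟩ := follows_free (A := A) (B := B) hrank hε hM hL₀ hL (w := w)
    (fun _ => rfl) hT hwm hzc hδ' y₀
  -- continuous functions on the whole line that agree with `y` and `z` on `[0, T]`
  let Y : ℝ → (Fin m → ℝ) := IccExtend hT.le ((Icc 0 T).domRestrict y)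
  let Z : ℝ → (Fin n → ℝ) := IccExtend hT.le ((Icc 0 T).domRestrict z)
  have hYc : Continuous Y := (continuousOn_iff_continuous_domRestrict.1 hy.continuousOn).Icc_extend'
  have hZc : Continuous Z := (continuousOn_iff_continuous_domRestrict.1 hzc).Icc_extend'
  have hY : ∀ t ∈ Icc 0 T, Y t = y t := fun t ht => IccExtend_of_mem _ _ ht
  have hZ : ∀ t ∈ Icc 0 T, Z t = z t := fun t ht => IccExtend_of_mem _ _ ht
  obtain ⟨x, hx, hx0⟩ := exists_isArc (f := fun t ζ => g (u t) (Y t) ζ) (K := L.toNNReal) (C := M)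
    (fun t => LipschitzWith.of_dist_le_mul fun ζ ζ' => by
      rw [dist_eq_norm, dist_eq_norm, Real.coe_toNNReal _ hL₀]
      simpa using hL (u t) (Y t) (Y t) ζ ζ')
    (fun t => hM _ _ _)
    (fun ζ hζ => (measurable_comp_simpleFunc hL₀ hL u hYc hζ).aestronglyMeasurable) hT z₀
  have hxs : IsSolution T 1 (fun t ζ => g (u t) (y t) ζ) (x 0) x :=
    isSolution_of_isArc hT.le hx fun t ht => by rw [one_smul, hY t (Ioo_subset_Icc_self ht)]
  have hys : IsSolution T ε (fun t η => A *ᵥ η + B *ᵥ u t) (y 0) y :=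
    isSolution_of_isArc hT.le hy fun t _ => smul_inv_smul₀ hε _
  refine ⟨x, ⟨u, y, u.measurable.aemeasurable, hy0 ▸ hys, hx0 ▸ hxs⟩, ?_⟩
  have hXc : ContinuousOn x (Icc 0 T) := hx.continuousOn
  let X : ℝ → (Fin n → ℝ) := IccExtend hT.le ((Icc 0 T).domRestrict x)
  have hXcc : Continuous X := (continuousOn_iff_continuous_domRestrict.1 hXc).Icc_extend'
  have hX : ∀ t ∈ Icc 0 T, X t = x t := fun t ht => IccExtend_of_mem _ _ ht
  have hgm : ∀ {ζ ξ : ℝ → (Fin n → ℝ)}, Continuous ξ → (∀ t ∈ Icc 0 T, ξ t = ζ t) →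
      AEStronglyMeasurable (fun t => g (u t) (Y t) (ζ t)) (volume.restrict (Ioc 0 T)) := by
    intro ζ ξ hξ hζ
    refine (measurable_comp_simpleFunc hL₀ hL u hYc hξ).aestronglyMeasurable.congr ?_
    rw [Filter.EventuallyEq, ae_restrict_iff' measurableSet_Ioc]
    exact Filter.Eventually.of_forall fun t ht => by rw [hζ t (Ioc_subset_Icc_self ht)]
  have hκ' : ∫⁻ t in Ioc 0 T, ‖g (u t) (Y t) (z t) - w t‖ₑ ≤ ENNReal.ofReal δ' := by
    refine le_of_eq_of_le (setLIntegral_congr_fun measurableSet_Ioc fun t ht => ?_) hκ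
    simp only [hY t (Ioc_subset_Icc_self ht)]
  have hbound := norm_le_of_ae_hasDerivAt (d := x - z) (D := fun t => g (u t) (Y t) (x t) - w t)
    (e := fun t => g (u t) (Y t) (z t) - w t) (C := M + M) (L := L) hT.le
    (hxs.absolutelyContinuous.sub hac) (by simp [hx0, hz0])
    (by filter_upwards [hx.ode, hzw] with t h1 h2 hI using (h1 hI).sub (h2 hI))
    ((hgm hXcc hX).sub hwm)
    (fun t => (norm_sub_le _ _).trans (add_le_add (hM _ _ _) (hM _ _ _)))
    ((hgm hZc hZ).sub hwm) hκ' hδ'.le hL₀ (fun t => by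
      have h1 := hL (u t) (Y t) (Y t) (x t) (z t)
      rw [sub_self, norm_zero, zero_add] at h1
      have h2 := norm_sub_le_norm_sub_add_norm_sub (g (u t) (Y t) (x t)) (g (u t) (Y t) (z t)) (w t)
      simp only [Pi.sub_apply]
      linarith)
  rwa [div_mul_cancel₀ _ (Real.exp_pos _).ne'] at hbound

lemma coupledTrajectories_subset_freeTrajectories (A : Matrix (Fin m) (Fin m) ℝ)
    (B : Matrix (Fin m) (Fin k) ℝ)
    (g : (Fin k → ℝ) → (Fin m → ℝ) → (Fin n → ℝ) → (Fin n → ℝ))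
    (y₀ : Fin m → ℝ) (z₀ : Fin n → ℝ) {T : ℝ} (hT : 0 ≤ T) (ε : ℝ) :
    coupledTrajectories A B g y₀ z₀ T ε ⊆ freeTrajectories g z₀ T := by
  rintro z ⟨u, y, hu, hy, hz⟩
  refine ⟨u, y, hu, ?_, hz⟩
  have := hy.absolutelyContinuous.continuousOn
  rw [uIcc_of_le hT] at this
  exact this.aemeasurable measurableSet_Icc

end Comparison

end TwoScale

theorem corollary1 {k m n : ℕ}
    (A : Matrix (Fin m) (Fin m) ℝ) (B : Matrix (Fin m) (Fin k) ℝ)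
    (hrank : (TwoScale.controllabilityMatrix A B).rank = m)
    (g : (Fin k → ℝ) → (Fin m → ℝ) → (Fin n → ℝ) → (Fin n → ℝ))
    (hbdd : ∃ M : ℝ, ∀ u y z, ‖g u y z‖ ≤ M)
    (hlip : ∃ L : ℝ, ∀ u y y' z z', ‖g u y z - g u y' z'‖ ≤ L * (‖y - y'‖ + ‖z - z'‖))
    (y₀ : Fin m → ℝ) (z₀ : Fin n → ℝ) (T : ℝ) (hT : 0 < T)
    (G : (Fin n → ℝ) → ℝ) (hG : Continuous G) :
    ∀ ε : ℝ, 0 < ε →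
      TwoScale.optimalValue G T (TwoScale.coupledTrajectories A B g y₀ z₀ T ε) =
        TwoScale.optimalValue G T (TwoScale.freeTrajectories g z₀ T) := by
  intro ε hε
  obtain ⟨M, hM⟩ := hbdd
  obtain ⟨L, hL⟩ := hlip
  have hL' : ∀ u y y' z z', ‖g u y z - g u y' z'‖ ≤ max L 0 * (‖y - y'‖ + ‖z - z'‖) :=
    fun u y y' z z' => (hL u y y' z z').trans
      (mul_le_mul_of_nonneg_right (le_max_left _ _) (by positivity))
  refine le_antisymm (le_iInf₂ fun z hz => ?_) (biInf_mono fun z hz =>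
    TwoScale.coupledTrajectories_subset_freeTrajectories A B g y₀ z₀ hT.le ε hz)
  refine EReal.le_of_forall_lt_iff_le.1 fun r hr => ?_
  have hr' : G (z T) < r := by exact_mod_cast hr
  obtain ⟨δ, hδ, hball⟩ := Metric.mem_nhds_iff.1
    ((isOpen_Iio.preimage hG).mem_nhds (show z T ∈ G ⁻¹' Iio r from hr'))
  obtain ⟨x, hx, hxz⟩ := TwoScale.exists_coupledTrajectory_near hrank hM (le_max_right L 0) hL' y₀ z₀
    hT hε.ne' hz (half_pos hδ)
  have hlt : G (x T) < r := hball (by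
    rw [Metric.mem_ball, dist_eq_norm]; exact hxz.trans_lt (half_lt_self hδ))
  exact (iInf₂_le x hx).trans (by exact_mod_cast hlt.le)
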